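/- **Setting.** A literal is a variable $v$ or its complement $\overline{v}$. A clause is a finite set of literals not containing any complementary pair, and a clause-set is a finite set of clauses. A clause-set $F$ is minimally unsatisfiable if it is unsatisfiable and $F \setminus \{C\}$ is satisfiable for every $C \in F$. For a set $D$ of literals let $\overline{D} := \{\overline{x} : x \in D\}$. DP-reduction of $F$ on a variable $v$ yields $$\mathrm{DP}_v(F) := \{C \in F : v \notin \mathrm{var}(C)\} \cup \{(C \cup D) \setminus \{v,\overline{v}\} : C, D \in F,\ C \cap \overline{D} = \{v\}\},$$ and $\mathrm{DP}_{v_1,\dots,v_n}(F)$ is obtained by performing DP-reduction successively on $v_1, \dots, v_n$, in this order. A variable $v$ is singular for $F$ if $\min(\mathrm{ld}_F(v), \mathrm{ld}_F(\overline{v})) = 1$, where $\mathrm{ld}_F(x)$ is the number of clauses of $F$ containing the literal $x$; and $F$ is nonsingular if no variable is singular for $F$. A tuple $(v_1,\dots,v_n)$ of variables, $n \ge 0$, is a singular tuple for $F$ if each $v_i$ is singular for $\mathrm{DP}_{v_1,\dots,v_{i-1}}(F)$; it is maximal if no singular tuple for $F$ properly extends it. For minimally unsatisfiable $F$, the singularity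 index $\mathrm{singind}(F)$ is the minimal length of a maximal singular tuple for $F$, and $\mathrm{sDP}(F)$ is the set of all nonsingular minimally unsatisfiable clause-sets obtainable from $F$ by zero, one or more steps $G \leadsto \mathrm{DP}_v(G)$ between minimally unsatisfiable clause-sets, with $v$ singular for $G$. **Theorem.** Let $F$ be a minimally unsatisfiable clause-set. Then a maximal singular tuple for $F$ exists (so that $\mathrm{singind}(F)$ is well-defined and attained), and every maximal singular tuple $(v_1,\dots,v_m)$ for $F$ has length $m = \mathrm{singind}(F)$. Consequently, all $F', F'' \in \mathrm{sDP}(F)$ have the same number of occurring variables, $n(F') = n(F'')$. -/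

import Mathlib

namespace MinUnsat

/-- A literal over the variables `V`: the pair `(v, true)` is the positive literal `v`,
the pair `(v, false)` is its complement. -/
abbrev Literal (V : Type*) := V × Bool

/-- The complement of a literal. -/
def Literal.compl {V : Type*} (x : Literal V) : Literal V := (x.1, !x.2)

section

variable {V : Type*} [DecidableEq V]

/-- The set of complements of the literals in a finite set of literals. -/
def complSet (L : Finset (Literal V)) : Finset (Literal V) := L.image Literal.compl

/-- A clause is a finite and clash-free set of literals. -/
def IsClause (C : Finset (Literal V)) : Prop := C ∩ complSet C = ∅

/-- A clause-set is a finite set of clauses. -/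
def IsClauseSet (F : Finset (Finset (Literal V))) : Prop := ∀ C ∈ F, IsClause C

/-- The variables occurring in a clause. -/
def clauseVar (C : Finset (Literal V)) : Finset V := C.image Prod.fst

/-- The variables occurring in a clause-set. -/
def var (F : Finset (Finset (Literal V))) : Finset V := F.biUnion clauseVar

/-- The number of variables occurring in a clause-set. -/
def numVars (F : Finset (Finset (Literal V))) : ℕ := (var F).card

/-- The literal-degree: the number of clauses in which the literal occurs. -/
def literalDegree (F : Finset (Finset (Literal V))) (x : Literal V) : ℕ :=
  (F.filter fun C => x ∈ C).card

/-- The resolvent on the variable `v` of two clauses that clash exactly in `v`. -/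
def resolvent (v : V) (C D : Finset (Literal V)) : Finset (Literal V) :=
  (C ∪ D) \ {(v, true), (v, false)}

/-- DP-reduction on the variable `v`: all clauses containing `v` are removed, and all resolvents
on `v` of clauses `C`, `D` with `C ∩ complSet D = {v}` are added. -/
def dp (v : V) (F : Finset (Finset (Literal V))) : Finset (Finset (Literal V)) :=
  (F.filter fun C => v ∉ clauseVar C) ∪
    ((F ×ˢ F).filter fun p => p.1 ∩ complSet p.2 = {(v, true)}).image
      fun p => resolvent v p.1 p.2

/-- Iterated DP-reduction, performed in the order of the list. -/
def dpList (vs : List V) (F : Finset (Finset (Literal V))) : Finset (Finset (Literal V)) :=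
  vs.foldl (fun G v => dp v G) F

/-- Some truth assignment makes at least one literal of every clause true. -/
def IsSat (F : Finset (Finset (Literal V))) : Prop :=
  ∃ f : V → Bool, ∀ C ∈ F, ∃ x ∈ C, f x.1 = x.2

/-- `F` is a minimally unsatisfiable clause-set: it is unsatisfiable, while removal of any clause
makes it satisfiable. -/
structure IsMU (F : Finset (Finset (Literal V))) : Prop where
  isClauseSet : IsClauseSet F
  not_isSat : ¬ IsSat F
  isSat_erase : ∀ C ∈ F, IsSat (F.erase C)

/-- The variable `v` is singular for `F`. -/
def IsSingular (F : Finset (Finset (Literal V))) (v : V) : Prop :=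
  min (literalDegree F (v, true)) (literalDegree F (v, false)) = 1

/-- `F` has no singular variables. -/
def IsNonsingular (F : Finset (Finset (Literal V))) : Prop := ∀ v, ¬ IsSingular F v

/-- One step of singular DP-reduction between minimally unsatisfiable clause-sets. -/
def SDPStep (F F' : Finset (Finset (Literal V))) : Prop :=
  IsMU F ∧ IsMU F' ∧ ∃ v, IsSingular F v ∧ F' = dp v F

/-- The set of nonsingular minimally unsatisfiable clause-sets that are obtained from `F` by zero,
one or more steps of singular DP-reduction. -/
def sdp (F : Finset (Finset (Literal V))) : Set (Finset (Finset (Literal V))) :=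
  {F' | IsMU F' ∧ IsNonsingular F' ∧ Relation.ReflTransGen SDPStep F F'}

/-- The tuple `vs` is singular for `F`: every entry is singular for the result of DP-reduction
of `F` on the preceding entries. -/
def IsSingularTuple (F : Finset (Finset (Literal V))) (vs : List V) : Prop :=
  ∀ (i : ℕ) (hi : i < vs.length), IsSingular (dpList (vs.take i) F) vs[i]

/-- A singular tuple is maximal if no other singular tuple extends it. -/
def IsMaximalSingularTuple (F : Finset (Finset (Literal V))) (vs : List V) : Prop :=
  IsSingularTuple F vs ∧ ∀ ws, IsSingularTuple F ws → vs <+: ws → ws = vs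

/-- The singularity index: the minimal length of a maximal singular tuple. -/
noncomputable def singind (F : Finset (Finset (Literal V))) : ℕ :=
  sInf {n | ∃ vs, IsMaximalSingularTuple F vs ∧ vs.length = n}

end

end MinUnsat

namespace MinUnsat

section

variable {V : Type*}

/-! If `a` occurs only in the main clause `C`, DP-reduction on its variable drops `C` and replaces
each clause containing `a.compl` by its resolvent with `C`. This preserves minimal unsatisfiability
and loses exactly one variable (`IsMain.isMU_dp`, `numVars_dp`). So reductions terminate, and
equality of lengths is a confluence argument by induction on the number of variables
(`IsMU.reducesIn_unique`).

Reductions on two singular variables commute (`dp_comm`), and each variable stays singular after the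
other is reduced, unless both have the same main clause and both complements have degree at least 2
(`isSingular_dp_or_shareMain`). For such an exceptional pair, the two first steps are compared
through a third singular variable that is exceptional with neither. If there is none, all singular
variables share that main clause, and either step already ends in a nonsingular clause-set
(`isNonsingular_dp`). The claim on `sdp` follows because the length fixes the number of variables
lost. -/

/-! ### Literals, clashes and main clauses. -/

theorem compl_fst (x : Literal V) : x.compl.1 = x.1 := rfl

theorem compl_compl (x : Literal V) : x.compl.compl = x := by
  simp [Literal.compl]

theorem eq_or_eq_compl {x y : Literal V} (h : x.1 = y.1) : x = y ∨ x = y.compl := by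
  obtain ⟨v, b⟩ := x
  obtain ⟨w, c⟩ := y
  obtain rfl : v = w := h
  cases b <;> cases c <;> simp [Literal.compl]

/-- The clauses `C` and `D` clash exactly in the literal `a` of `C`. -/
def Clash (a : Literal V) (C D : Finset (Literal V)) : Prop :=
  ∀ x, (x ∈ C ∧ x.compl ∈ D) ↔ x = a

theorem Clash.symm {a : Literal V} {C D : Finset (Literal V)} (h : Clash a C D) :
    Clash a.compl D C := by
  intro x
  have := h x.compl
  rw [compl_compl] at this
  rw [and_comm, this]
  constructor
  · rintro rfl
    rw [compl_compl]
  · rintro rfl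
    rw [compl_compl]

theorem true_of_compl_not_true {f : V → Bool} {x : Literal V} (h : f x.compl.1 ≠ x.compl.2) :
    f x.1 = x.2 := by
  simpa [Literal.compl] using h

/-- The literal `a` witnesses that its variable is singular: `C` is the only clause of `F`
containing `a`, while the complement of `a` occurs in `F`. -/
structure IsMain (F : Finset (Finset (Literal V))) (a : Literal V) (C : Finset (Literal V)) :
    Prop where
  mem : C ∈ F
  lit_mem : a ∈ C
  unique : ∀ D ∈ F, a ∈ D → D = C
  exists_side : ∃ D ∈ F, a.compl ∈ D

theorem IsMain.notMem_of_ne {F : Finset (Finset (Literal V))} {a : Literal V}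
    {C D : Finset (Literal V)} (h : IsMain F a C) (hD : D ∈ F) (hne : D ≠ C) : a ∉ D :=
  fun ha => hne (h.unique D hD ha)

variable [DecidableEq V]

theorem mem_complSet {L : Finset (Literal V)} {x : Literal V} :
    x ∈ complSet L ↔ x.compl ∈ L := by
  simp only [complSet, Finset.mem_image]
  constructor
  · rintro ⟨y, hy, rfl⟩
    rwa [compl_compl]
  · exact fun h => ⟨_, h, compl_compl x⟩

theorem isClause_iff {C : Finset (Literal V)} :
    IsClause C ↔ ∀ x ∈ C, x.compl ∉ C := by
  simp only [IsClause, Finset.eq_empty_iff_forall_notMem, Finset.mem_inter, mem_complSet, not_and]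

theorem inter_complSet_eq_iff {a : Literal V} {C D : Finset (Literal V)} :
    C ∩ complSet D = {a} ↔ Clash a C D := by
  simp only [Finset.ext_iff, Finset.mem_inter, mem_complSet, Finset.mem_singleton, Clash]

theorem mem_resolvent {v : V} {C D : Finset (Literal V)} {x : Literal V} :
    x ∈ resolvent v C D ↔ (x ∈ C ∨ x ∈ D) ∧ x.1 ≠ v := by
  obtain ⟨w, b⟩ := x
  cases b <;> simp [resolvent]

theorem resolvent_comm (v : V) (C D : Finset (Literal V)) :
    resolvent v C D = resolvent v D C := by
  rw [resolvent, resolvent, Finset.union_comm]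

theorem mem_clauseVar {C : Finset (Literal V)} {a : Literal V} :
    a.1 ∈ clauseVar C ↔ a ∈ C ∨ a.compl ∈ C := by
  simp only [clauseVar, Finset.mem_image]
  constructor
  · rintro ⟨x, hx, h⟩
    rcases eq_or_eq_compl h with rfl | rfl
    · exact Or.inl hx
    · exact Or.inr hx
  · rintro (h | h)
    · exact ⟨_, h, rfl⟩
    · exact ⟨_, h, rfl⟩

/-- The definition singles out the positive literal; clashes and resolvents are symmetric, so either
sign of `a` will do. -/
theorem mem_dp {F : Finset (Finset (Literal V))} (a : Literal V) {R : Finset (Literal V)} :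
    R ∈ dp a.1 F ↔ (R ∈ F ∧ a ∉ R ∧ a.compl ∉ R) ∨
      ∃ C ∈ F, ∃ D ∈ F, Clash a C D ∧ R = resolvent a.1 C D := by
  simp only [dp, Finset.mem_union, Finset.mem_filter, Finset.mem_image, Finset.mem_product,
    mem_clauseVar, not_or, Prod.exists, inter_complSet_eq_iff]
  refine or_congr Iff.rfl ?_
  obtain ⟨v, b⟩ := a
  cases b
  · constructor
    · rintro ⟨C, D, ⟨⟨hC, hD⟩, h⟩, rfl⟩
      exact ⟨D, hD, C, hC, h.symm, resolvent_comm _ _ _⟩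
    · rintro ⟨C, hC, D, hD, h, rfl⟩
      exact ⟨D, C, ⟨⟨hD, hC⟩, h.symm⟩, resolvent_comm _ _ _⟩
  · constructor
    · rintro ⟨C, D, ⟨⟨hC, hD⟩, h⟩, rfl⟩
      exact ⟨C, hC, D, hD, h, rfl⟩
    · rintro ⟨C, hC, D, hD, h, rfl⟩
      exact ⟨C, D, ⟨⟨hC, hD⟩, h⟩, rfl⟩

theorem literalDegree_pos {F : Finset (Finset (Literal V))} {x : Literal V} :
    0 < literalDegree F x ↔ ∃ D ∈ F, x ∈ D := by
  simp [literalDegree, Finset.card_pos, Finset.Nonempty]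

theorem exists_isMain {F : Finset (Finset (Literal V))} {a : Literal V}
    (h1 : literalDegree F a = 1) (h2 : 0 < literalDegree F a.compl) : ∃ C, IsMain F a C := by
  obtain ⟨C, hC⟩ := Finset.card_eq_one.1 h1
  have h : ∀ D, (D ∈ F ∧ a ∈ D) ↔ D = C := fun D => by
    rw [← Finset.mem_singleton, ← hC, Finset.mem_filter]
  exact ⟨C, ((h C).2 rfl).1, ((h C).2 rfl).2, fun D hD ha => (h D).1 ⟨hD, ha⟩,
    literalDegree_pos.1 h2⟩

theorem IsMain.literalDegree_eq {F : Finset (Finset (Literal V))} {a : Literal V}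
    {C : Finset (Literal V)} (h : IsMain F a C) : literalDegree F a = 1 := by
  refine Finset.card_eq_one.2 ⟨C, ?_⟩
  ext D
  rw [Finset.mem_filter, Finset.mem_singleton]
  constructor
  · exact fun hD => h.unique D hD.1 hD.2
  · rintro rfl
    exact ⟨h.mem, h.lit_mem⟩

theorem isSingular_iff_literal {F : Finset (Finset (Literal V))} (a : Literal V) :
    IsSingular F a.1 ↔ min (literalDegree F a) (literalDegree F a.compl) = 1 := by
  obtain ⟨v, b⟩ := a
  cases b
  · rw [min_comm]
    rfl
  · rfl

theorem IsMain.isSingular {F : Finset (Finset (Literal V))} {a : Literal V}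
    {C : Finset (Literal V)} (h : IsMain F a C) : IsSingular F a.1 := by
  have h1 := h.literalDegree_eq
  have h2 := literalDegree_pos.2 h.exists_side
  rw [isSingular_iff_literal]
  omega

theorem isSingular_iff {F : Finset (Finset (Literal V))} {v : V} :
    IsSingular F v ↔ ∃ a C, a.1 = v ∧ IsMain F a C := by
  constructor
  · intro h
    have h' : min (literalDegree F (v, true)) (literalDegree F (v, false)) = 1 := h
    rcases Nat.le_total (literalDegree F (v, true)) (literalDegree F (v, false)) with hle | hle
    · obtain ⟨C, hC⟩ := exists_isMain (F := F) (a := (v, true)) (by omega)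
        (show 0 < literalDegree F (v, false) by omega)
      exact ⟨_, C, rfl, hC⟩
    · obtain ⟨C, hC⟩ := exists_isMain (F := F) (a := (v, false)) (by omega)
        (show 0 < literalDegree F (v, true) by omega)
      exact ⟨_, C, rfl, hC⟩
  · rintro ⟨a, C, rfl, h⟩
    exact h.isSingular

/-! ### Singular DP-reduction preserves minimal unsatisfiability. -/

/-- Changing the assignment `f` such that the literal `a` becomes true. -/
def setTrue (f : V → Bool) (a : Literal V) : V → Bool := Function.update f a.1 a.2

theorem setTrue_self (f : V → Bool) (a : Literal V) : setTrue f a a.1 = a.2 := by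
  simp [setTrue]

theorem setTrue_of_ne {f : V → Bool} {a x : Literal V} (hx : f x.1 = x.2) (h : x ≠ a.compl) :
    setTrue f a x.1 = x.2 := by
  by_cases hv : x.1 = a.1
  · rcases eq_or_eq_compl hv with rfl | h'
    · exact setTrue_self f x
    · exact absurd h' h
  · simpa [setTrue, hv] using hx

theorem IsMU.exists_falsifying {F : Finset (Finset (Literal V))} (hF : IsMU F)
    {D : Finset (Literal V)} (hD : D ∈ F) :
    ∃ f : V → Bool, (∀ x ∈ D, f x.1 ≠ x.2) ∧ ∀ E ∈ F, E ≠ D → ∃ x ∈ E, f x.1 = x.2 := by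
  obtain ⟨f, hf⟩ := hF.isSat_erase D hD
  have hf' : ∀ E ∈ F, E ≠ D → ∃ x ∈ E, f x.1 = x.2 :=
    fun E hE hne => hf E (Finset.mem_erase.2 ⟨hne, hE⟩)
  refine ⟨f, fun x hx hfx => hF.not_isSat ⟨f, fun E hE => ?_⟩, hf'⟩
  by_cases h : E = D
  · subst h
    exact ⟨x, hx, hfx⟩
  · exact hf' E hE h

/-- In a minimally unsatisfiable clause-set, the main clause of a singular variable clashes with
every side clause exactly in this variable. -/
theorem IsMain.clash {F : Finset (Finset (Literal V))} {a : Literal V} {C D : Finset (Literal V)}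
    (h : IsMain F a C) (hF : IsMU F) (hD : D ∈ F) (ha : a.compl ∈ D) : Clash a C D := by
  intro y
  constructor
  · rintro ⟨hyC, hyD⟩
    by_contra hya
    obtain ⟨f, hfD, hf⟩ := hF.exists_falsifying hD
    have hcl := isClause_iff.1 (hF.isClauseSet C h.mem)
    -- `f` falsifies only `D`. Making `a.compl` true repairs `D` and can only hurt `C`, which the
    -- second clash `y` keeps satisfied.
    refine hF.not_isSat ⟨setTrue f a.compl, fun E hE => ?_⟩
    by_cases hED : E = D
    · subst hED
      exact ⟨_, ha, setTrue_self _ _⟩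
    by_cases hEC : E = C
    · subst hEC
      refine ⟨y, hyC, setTrue_of_ne (true_of_compl_not_true (hfD _ hyD)) ?_⟩
      rwa [compl_compl]
    · obtain ⟨x, hx, hfx⟩ := hf E hE hED
      refine ⟨x, hx, setTrue_of_ne hfx ?_⟩
      rw [compl_compl]
      rintro rfl
      exact hEC (h.unique E hE hx)
  · rintro rfl
    exact ⟨h.lit_mem, ha⟩

/-- The effect of singular DP-reduction with main clause `C` and singular literal `a` on a
clause `D` different from `C`. -/
def dpImage (a : Literal V) (C D : Finset (Literal V)) : Finset (Literal V) :=
  if a.compl ∈ D then resolvent a.1 C D else D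

theorem mem_dpImage {a : Literal V} {C D : Finset (Literal V)} {x : Literal V}
    (h : x.1 ≠ a.1) : x ∈ dpImage a C D ↔ x ∈ D ∨ (a.compl ∈ D ∧ x ∈ C) := by
  unfold dpImage
  split_ifs with hD
  · rw [mem_resolvent]
    tauto
  · tauto

theorem IsMain.fst_ne {F : Finset (Finset (Literal V))} {a : Literal V}
    {C D : Finset (Literal V)} (h : IsMain F a C) (hD : D ∈ F) (hne : D ≠ C) {x : Literal V}
    (hx : x ∈ dpImage a C D) : x.1 ≠ a.1 := by
  unfold dpImage at hx
  split_ifs at hx with hD'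
  · exact (mem_resolvent.1 hx).2
  · intro hv
    rcases eq_or_eq_compl hv with rfl | rfl
    · exact h.notMem_of_ne hD hne hx
    · exact hD' hx

/-- A parent clause containing `a` can only be `C`, and by `IsMain.clash` every side clause does
resolve with it. -/
theorem IsMain.dp_eq {F : Finset (Finset (Literal V))} {a : Literal V} {C : Finset (Literal V)}
    (h : IsMain F a C) (hF : IsMU F) : dp a.1 F = (F.erase C).image (dpImage a C) := by
  have hcl := isClause_iff.1 (hF.isClauseSet C h.mem)
  ext R
  rw [mem_dp]
  simp only [Finset.mem_image, Finset.mem_erase]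
  constructor
  · rintro (⟨hR, ha, hac⟩ | ⟨P, hP, Q, hQ, hPQ, rfl⟩)
    · refine ⟨R, ⟨?_, hR⟩, if_neg hac⟩
      rintro rfl
      exact ha h.lit_mem
    · obtain ⟨haP, haQ⟩ := (hPQ a).2 rfl
      obtain rfl := h.unique P hP haP
      refine ⟨Q, ⟨?_, hQ⟩, if_pos haQ⟩
      rintro rfl
      exact hcl a haP haQ
  · rintro ⟨D, ⟨hne, hD⟩, rfl⟩
    unfold dpImage
    split_ifs with hD'
    · exact Or.inr ⟨C, h.mem, D, hD, h.clash hF hD hD', rfl⟩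
    · exact Or.inl ⟨hD, h.notMem_of_ne hD hne, hD'⟩

/-- An assignment satisfying the main clause and a further clause satisfies the result of the
singular DP-reduction. -/
theorem IsMain.dpImage_true {F : Finset (Finset (Literal V))} {a : Literal V}
    {C D : Finset (Literal V)} (h : IsMain F a C) (hD : D ∈ F) (hne : D ≠ C)
    {f : V → Bool} (hC : ∃ x ∈ C, f x.1 = x.2) (hfD : ∃ x ∈ D, f x.1 = x.2)
    (hcl : ∀ x ∈ C, x.compl ∉ C) :
    ∃ x ∈ dpImage a C D, f x.1 = x.2 := by
  obtain ⟨x, hx, hfx⟩ := hC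
  obtain ⟨y, hy, hfy⟩ := hfD
  by_cases hyv : y.1 = a.1
  · rcases eq_or_eq_compl hyv with rfl | rfl
    · exact absurd hy (h.notMem_of_ne hD hne)
    · refine ⟨x, (mem_dpImage ?_).2 (Or.inr ⟨hy, hx⟩), hfx⟩
      intro hxv
      rcases eq_or_eq_compl hxv with rfl | rfl
      · rw [compl_fst, hfx] at hfy
        simp [Literal.compl] at hfy
      · exact hcl a h.lit_mem hx
  · exact ⟨y, (mem_dpImage hyv).2 (Or.inl hy), hfy⟩

/-- A model of the reduct extends to `F`: if it satisfies `C` outside the variable of `a`, make `a`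
false, which satisfies the side clauses; otherwise make `a` true, since the resolvents must then be
satisfied by their side-clause parts. -/
theorem IsMain.not_isSat_dp {F : Finset (Finset (Literal V))} {a : Literal V}
    {C : Finset (Literal V)} (h : IsMain F a C) (hF : IsMU F) : ¬ IsSat (dp a.1 F) := by
  rw [h.dp_eq hF]
  rintro ⟨g, hg⟩
  have hg' : ∀ D ∈ F, D ≠ C → ∃ x ∈ dpImage a C D, g x.1 = x.2 := fun D hD hne =>
    hg _ (Finset.mem_image_of_mem _ (Finset.mem_erase.2 ⟨hne, hD⟩))
  by_cases hC : ∃ x ∈ C, x.1 ≠ a.1 ∧ g x.1 = x.2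
  · obtain ⟨x, hx, hxa, hgx⟩ := hC
    refine hF.not_isSat ⟨setTrue g a.compl, fun D hD => ?_⟩
    by_cases hne : D = C
    · subst hne
      refine ⟨x, hx, setTrue_of_ne hgx ?_⟩
      rintro rfl
      exact hxa rfl
    · by_cases haD : a.compl ∈ D
      · exact ⟨_, haD, setTrue_self _ _⟩
      · obtain ⟨y, hy, hgy⟩ := hg' D hD hne
        have hya := h.fst_ne hD hne hy
        rw [dpImage, if_neg haD] at hy
        refine ⟨y, hy, setTrue_of_ne hgy ?_⟩
        rintro rfl
        exact hya rfl
  · refine hF.not_isSat ⟨setTrue g a, fun D hD => ?_⟩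
    by_cases hne : D = C
    · subst hne
      exact ⟨a, h.lit_mem, setTrue_self _ _⟩
    · obtain ⟨y, hy, hgy⟩ := hg' D hD hne
      have hya := h.fst_ne hD hne hy
      refine ⟨y, ?_, setTrue_of_ne hgy ?_⟩
      · rcases (mem_dpImage hya).1 hy with hy' | ⟨-, hy'⟩
        · exact hy'
        · exact absurd ⟨y, hy', hya, hgy⟩ hC
      · rintro rfl
        exact hya rfl

/-- A model of `F` without `D` still satisfies `C`, hence also the images of all remaining clauses.
This gives both injectivity of `dpImage` and minimality of the reduct. -/
theorem IsMain.exists_true_except {F : Finset (Finset (Literal V))} {a : Literal V}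
    {C D : Finset (Literal V)} (h : IsMain F a C) (hF : IsMU F) (hD : D ∈ F) (hne : D ≠ C) :
    ∃ f : V → Bool, ∀ E ∈ F, E ≠ C → E ≠ D → ∃ x ∈ dpImage a C E, f x.1 = x.2 := by
  obtain ⟨f, -, hf⟩ := hF.exists_falsifying hD
  exact ⟨f, fun E hE hEC hED => h.dpImage_true hE hEC (hf C h.mem hne.symm) (hf E hE hED)
    (isClause_iff.1 (hF.isClauseSet C h.mem))⟩

/-- If two clauses had the same image, a model of the images other than that of `D` would satisfy
the whole reduct. -/
theorem IsMain.injOn_dpImage {F : Finset (Finset (Literal V))} {a : Literal V}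
    {C : Finset (Literal V)} (h : IsMain F a C) (hF : IsMU F) :
    Set.InjOn (dpImage a C) (F.erase C : Finset (Finset (Literal V))) := by
  intro D hD E hE hDE
  by_contra hne
  rw [Finset.mem_coe, Finset.mem_erase] at hD hE
  obtain ⟨f, hf⟩ := h.exists_true_except hF hD.2 hD.1
  refine h.not_isSat_dp hF ⟨f, fun R hR => ?_⟩
  rw [h.dp_eq hF, Finset.mem_image] at hR
  obtain ⟨B, hB, rfl⟩ := hR
  rw [Finset.mem_erase] at hB
  by_cases hBD : B = D
  · rw [hBD, hDE]
    exact hf E hE.2 hE.1 (Ne.symm hne)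
  · exact hf B hB.2 hB.1 hBD

theorem IsMain.isMU_dp {F : Finset (Finset (Literal V))} {a : Literal V}
    {C : Finset (Literal V)} (h : IsMain F a C) (hF : IsMU F) : IsMU (dp a.1 F) := by
  refine ⟨fun R hR => ?_, h.not_isSat_dp hF, fun R hR => ?_⟩
  · rw [h.dp_eq hF, Finset.mem_image] at hR
    obtain ⟨D, hD, rfl⟩ := hR
    rw [Finset.mem_erase] at hD
    have hDcl := isClause_iff.1 (hF.isClauseSet D hD.2)
    have hCcl := isClause_iff.1 (hF.isClauseSet C h.mem)
    rw [isClause_iff]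
    intro x hx hxc
    have hxa := h.fst_ne hD.2 hD.1 hx
    rw [mem_dpImage hxa] at hx
    rw [mem_dpImage (by exact hxa)] at hxc
    rcases hx with hx | ⟨ha, hx⟩ <;> rcases hxc with hxc | ⟨ha', hxc⟩
    · exact hDcl x hx hxc
    · have := (h.clash hF hD.2 ha' x.compl).1 ⟨hxc, by rwa [compl_compl]⟩
      have hfst := congrArg Prod.fst this
      exact hxa hfst
    · have := (h.clash hF hD.2 ha x).1 ⟨hx, hxc⟩
      exact hxa (congrArg Prod.fst this)
    · exact hCcl x hx hxc
  · rw [h.dp_eq hF] at hR ⊢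
    obtain ⟨D, hD, rfl⟩ := Finset.mem_image.1 hR
    rw [Finset.mem_erase] at hD
    obtain ⟨f, hf⟩ := h.exists_true_except hF hD.2 hD.1
    refine ⟨f, fun E hE => ?_⟩
    obtain ⟨hne, hE⟩ := Finset.mem_erase.1 hE
    obtain ⟨B, hB, rfl⟩ := Finset.mem_image.1 hE
    rw [Finset.mem_erase] at hB
    refine hf B hB.2 hB.1 ?_
    rintro rfl
    exact hne rfl

/-! ### Literal degrees and the number of variables after a reduction. -/

theorem IsMain.literalDegree_dp {F : Finset (Finset (Literal V))} {a : Literal V}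
    {C : Finset (Literal V)} (h : IsMain F a C) (hF : IsMU F) {x : Literal V}
    (hx : x.1 ≠ a.1) : literalDegree (dp a.1 F) x =
      ((F.erase C).filter fun D => x ∈ D ∨ (a.compl ∈ D ∧ x ∈ C)).card := by
  rw [literalDegree, h.dp_eq hF, Finset.filter_image, Finset.card_image_of_injOn]
  · congr 1
    ext D
    simp only [Finset.mem_filter, mem_dpImage hx]
  · exact (h.injOn_dpImage hF).mono (Finset.coe_subset.2 (Finset.filter_subset _ _))

theorem IsMain.literalDegree_dp_of_notMem {F : Finset (Finset (Literal V))} {a : Literal V}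
    {C : Finset (Literal V)} (h : IsMain F a C) (hF : IsMU F) {x : Literal V}
    (hx : x.1 ≠ a.1) (hxC : x ∉ C) : literalDegree (dp a.1 F) x = literalDegree F x := by
  rw [h.literalDegree_dp hF hx, literalDegree]
  congr 1
  ext D
  simp only [Finset.mem_filter, Finset.mem_erase]
  constructor
  · tauto
  · rintro ⟨hD, hxD⟩
    refine ⟨⟨?_, hD⟩, Or.inl hxD⟩
    rintro rfl
    exact hxC hxD

/-- Every side clause receives a copy of each literal of `C` other than `a`. -/
theorem IsMain.literalDegree_compl_le {F : Finset (Finset (Literal V))} {a : Literal V}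
    {C : Finset (Literal V)} (h : IsMain F a C) (hF : IsMU F) {x : Literal V}
    (hx : x.1 ≠ a.1) (hxC : x ∈ C) :
    literalDegree F a.compl ≤ literalDegree (dp a.1 F) x := by
  rw [h.literalDegree_dp hF hx, literalDegree]
  refine Finset.card_le_card fun D hD => ?_
  simp only [Finset.mem_filter, Finset.mem_erase] at hD ⊢
  refine ⟨⟨?_, hD.1⟩, Or.inr ⟨hD.2, hxC⟩⟩
  rintro rfl
  exact isClause_iff.1 (hF.isClauseSet D h.mem) a h.lit_mem hD.2

theorem IsMain.literalDegree_dp_pos_iff {F : Finset (Finset (Literal V))} {a : Literal V}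
    {C : Finset (Literal V)} (h : IsMain F a C) (hF : IsMU F) {x : Literal V}
    (hx : x.1 ≠ a.1) : 0 < literalDegree (dp a.1 F) x ↔ 0 < literalDegree F x := by
  by_cases hxC : x ∈ C
  · have h1 := h.literalDegree_compl_le hF hx hxC
    have h2 := literalDegree_pos.2 h.exists_side
    have h3 : 0 < literalDegree F x := literalDegree_pos.2 ⟨C, h.mem, hxC⟩
    omega
  · rw [h.literalDegree_dp_of_notMem hF hx hxC]

theorem IsMain.literalDegree_dp_self {F : Finset (Finset (Literal V))} {a : Literal V}
    {C : Finset (Literal V)} (h : IsMain F a C) (hF : IsMU F) {x : Literal V}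
    (hx : x.1 = a.1) : literalDegree (dp a.1 F) x = 0 := by
  by_contra h0
  obtain ⟨R, hR, hxR⟩ := literalDegree_pos.1 (Nat.pos_of_ne_zero h0)
  rw [h.dp_eq hF, Finset.mem_image] at hR
  obtain ⟨D, hD, rfl⟩ := hR
  rw [Finset.mem_erase] at hD
  exact h.fst_ne hD.2 hD.1 hxR hx

theorem mem_var {F : Finset (Finset (Literal V))} {v : V} :
    v ∈ var F ↔ ∃ x : Literal V, x.1 = v ∧ 0 < literalDegree F x := by
  simp only [var, Finset.mem_biUnion, clauseVar, Finset.mem_image, literalDegree_pos]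
  constructor
  · rintro ⟨D, hD, x, hx, rfl⟩
    exact ⟨x, rfl, D, hD, hx⟩
  · rintro ⟨x, rfl, D, hD, hx⟩
    exact ⟨D, hD, x, hx, rfl⟩

theorem numVars_dp {F : Finset (Finset (Literal V))} (hF : IsMU F) {v : V}
    (hv : IsSingular F v) : numVars (dp v F) + 1 = numVars F := by
  obtain ⟨a, C, rfl, h⟩ := isSingular_iff.1 hv
  have hvar : var (dp a.1 F) = (var F).erase a.1 := by
    ext w
    rw [Finset.mem_erase, mem_var, mem_var]
    constructor
    · rintro ⟨x, rfl, hx⟩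
      by_cases hxa : x.1 = a.1
      · rw [h.literalDegree_dp_self hF hxa] at hx
        exact absurd hx (lt_irrefl 0)
      · exact ⟨hxa, x, rfl, (h.literalDegree_dp_pos_iff hF hxa).1 hx⟩
    · rintro ⟨hne, x, rfl, hx⟩
      exact ⟨x, rfl, (h.literalDegree_dp_pos_iff hF hne).2 hx⟩
  have hmem : a.1 ∈ var F := mem_var.2 ⟨a, rfl, literalDegree_pos.2 ⟨C, h.mem, h.lit_mem⟩⟩
  rw [numVars, numVars, hvar]
  exact Finset.card_erase_add_one hmem

theorem isMU_dp {F : Finset (Finset (Literal V))} (hF : IsMU F) {v : V}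
    (hv : IsSingular F v) : IsMU (dp v F) := by
  obtain ⟨a, C, rfl, h⟩ := isSingular_iff.1 hv
  exact h.isMU_dp hF

/-! ### Commutation of two reductions. -/

theorem mem_resolvent_iff {a : Literal V} {C D : Finset (Literal V)} {x : Literal V} :
    x ∈ resolvent a.1 C D ↔ (x ∈ C ∨ x ∈ D) ∧ x ≠ a ∧ x ≠ a.compl := by
  rw [mem_resolvent]
  refine and_congr_right fun _ => ⟨fun h => ⟨?_, ?_⟩, fun h h' => ?_⟩
  · rintro rfl
    exact h rfl
  · rintro rfl
    exact h rfl
  · exact (eq_or_eq_compl h').elim h.1 h.2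

/-- Here `b` enters the first resolvent from `C` alone, so only `C` need be resolved with `Q`
beforehand. -/
theorem exchange_left_main {a b : Literal V} {C D Q : Finset (Literal V)} (hab : a.1 ≠ b.1)
    (hCD : Clash a C D) (hQ : a ∉ Q ∧ a.compl ∉ Q) (hR : Clash b (resolvent a.1 C D) Q)
    (hC : ∀ x ∈ C, x.compl ∉ C) (hbC : b ∈ C) (hbD : b ∉ D) :
    Clash b C Q ∧ Clash a (resolvent b.1 C Q) D ∧
      resolvent b.1 (resolvent a.1 C D) Q = resolvent a.1 (resolvent b.1 C Q) D := by
  have hcc : ∀ x : Literal V, x.compl.compl = x := compl_compl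
  have h1 : a ≠ b := fun h => hab (congrArg Prod.fst h)
  have h2 : a ≠ b.compl := by
    rintro rfl
    exact hab rfl
  unfold Clash at *
  simp only [mem_resolvent_iff, Finset.ext_iff] at *
  grind

/-- Here both parents contribute `b`, so each has to be resolved with `Q`. -/
theorem exchange_both {a b : Literal V} {C D Q : Finset (Literal V)} (hab : a.1 ≠ b.1)
    (hCD : Clash a C D) (hQ : a ∉ Q ∧ a.compl ∉ Q) (hR : Clash b (resolvent a.1 C D) Q)
    (hQcl : ∀ x ∈ Q, x.compl ∉ Q) (hbC : b ∈ C) (hbD : b ∈ D) :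
    Clash b C Q ∧ Clash b D Q ∧ Clash a (resolvent b.1 C Q) (resolvent b.1 D Q) ∧
      resolvent b.1 (resolvent a.1 C D) Q =
        resolvent a.1 (resolvent b.1 C Q) (resolvent b.1 D Q) := by
  have hcc : ∀ x : Literal V, x.compl.compl = x := compl_compl
  have h1 : a ≠ b := fun h => hab (congrArg Prod.fst h)
  have h2 : a ≠ b.compl := by
    rintro rfl
    exact hab rfl
  unfold Clash at *
  simp only [mem_resolvent_iff, Finset.ext_iff] at *
  grind

theorem mem_dpImage_iff {a : Literal V} {C D : Finset (Literal V)} (ha : a ∉ D)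
    {x : Literal V} :
    x ∈ dpImage a C D ↔ (x ∈ D ∨ (a.compl ∈ D ∧ x ∈ C)) ∧ x ≠ a ∧ x ≠ a.compl := by
  unfold dpImage
  split_ifs with hD
  · rw [mem_resolvent_iff]
    tauto
  · constructor
    · intro hx
      refine ⟨Or.inl hx, ?_, ?_⟩
      · rintro rfl
        exact ha hx
      · rintro rfl
        exact hD hx
    · tauto

/-- As `C` is free of the variable of `b`, it can be resolved in once at the end, even if both `D`
and `E` are side clauses. -/
theorem exchange_side {a b : Literal V} {C D E : Finset (Literal V)} (hab : a.1 ≠ b.1)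
    (hC : ∀ x ∈ C, x.compl ∉ C) (hD : a ∉ D) (hE : a ∉ E)
    (hCD : a.compl ∈ D → Clash a C D) (hCE : a.compl ∈ E → Clash a C E)
    (hDE : a.compl ∈ D ∨ a.compl ∈ E) (haC : a ∈ C) (hbC : b ∉ C) (hbC' : b.compl ∉ C)
    (hR : Clash b (dpImage a C D) (dpImage a C E)) :
    Clash b D E ∧ Clash a C (resolvent b.1 D E) ∧
      resolvent b.1 (dpImage a C D) (dpImage a C E) = resolvent a.1 C (resolvent b.1 D E) := by
  have hcc : ∀ x : Literal V, x.compl.compl = x := compl_compl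
  have h1 : a ≠ b := fun h => hab (congrArg Prod.fst h)
  have h2 : a ≠ b.compl := by
    rintro rfl
    exact hab rfl
  unfold Clash at *
  simp only [mem_resolvent_iff, mem_dpImage_iff hD, mem_dpImage_iff hE, Finset.ext_iff] at *
  refine ⟨?_, ?_, ?_⟩
  · grind
  · grind
  · grind

/-- Reductions of two singular variables can be exchanged, one inclusion. -/
theorem IsMain.dp_dp_subset {F : Finset (Finset (Literal V))} {a b : Literal V}
    {C : Finset (Literal V)} (h : IsMain F a C) (hF : IsMU F) (hab : a.1 ≠ b.1)
    (hbC : b.compl ∉ C) : dp b.1 (dp a.1 F) ⊆ dp a.1 (dp b.1 F) := by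
  intro R hR
  have hcl := isClause_iff.1 (hF.isClauseSet C h.mem)
  have hmem : ∀ {X}, X ∈ dp a.1 F → ∃ D ∈ F, D ≠ C ∧ dpImage a C D = X := by
    intro X hX
    rw [h.dp_eq hF, Finset.mem_image] at hX
    obtain ⟨D, hD, rfl⟩ := hX
    rw [Finset.mem_erase] at hD
    exact ⟨D, hD.2, hD.1, rfl⟩
  rw [mem_dp a]
  rw [mem_dp b] at hR
  rcases hR with ⟨hR, hb, hb'⟩ | ⟨X, hX, Y, hY, hXY, rfl⟩
  · obtain ⟨D, hD, hne, rfl⟩ := hmem hR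
    have haD := h.notMem_of_ne hD hne
    rw [mem_dpImage (Ne.symm hab)] at hb
    rw [mem_dpImage (x := b.compl) (Ne.symm hab)] at hb'
    push Not at hb hb'
    have hDb : D ∈ dp b.1 F := (mem_dp b).2 (Or.inl ⟨hD, hb.1, hb'.1⟩)
    unfold dpImage
    split_ifs with ha
    · exact Or.inr ⟨C, (mem_dp b).2 (Or.inl ⟨h.mem, hb.2 ha, hbC⟩), D, hDb,
        h.clash hF hD ha, rfl⟩
    · exact Or.inl ⟨hDb, haD, ha⟩
  · have hYcl := isClause_iff.1 ((h.isMU_dp hF).isClauseSet Y hY)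
    obtain ⟨D, hD, hDC, rfl⟩ := hmem hX
    obtain ⟨E, hE, hEC, rfl⟩ := hmem hY
    have haD := h.notMem_of_ne hD hDC
    have haE := h.notMem_of_ne hE hEC
    have hres : ∀ {P Q}, P ∈ F → Q ∈ F → Clash b P Q → resolvent b.1 P Q ∈ dp b.1 F :=
      fun hP hQ hPQ => (mem_dp b).2 (Or.inr ⟨_, hP, _, hQ, hPQ, rfl⟩)
    by_cases hside : a.compl ∈ D ∨ a.compl ∈ E
    · by_cases hb : b ∈ C
      · have haE' : a.compl ∉ E := by
          intro ha
          exact hYcl b ((mem_dpImage (Ne.symm hab)).2 (Or.inr ⟨ha, hb⟩)) ((hXY b).2 rfl).2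
        have haD' := hside.resolve_right haE'
        have hCD := h.clash hF hD haD'
        rw [dpImage, if_pos haD'] at hXY ⊢
        rw [dpImage, if_neg haE'] at hXY ⊢
        have hEcl := isClause_iff.1 (hF.isClauseSet E hE)
        by_cases hbD : b ∈ D
        · obtain ⟨h1, h2, h3, h4⟩ := exchange_both hab hCD ⟨haE, haE'⟩ hXY hEcl hb hbD
          exact Or.inr ⟨_, hres h.mem hE h1, _, hres hD hE h2, h3, h4⟩
        · obtain ⟨h1, h2, h3⟩ := exchange_left_main hab hCD ⟨haE, haE'⟩ hXY hcl hb hbD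
          refine Or.inr ⟨_, hres h.mem hE h1, D, (mem_dp b).2 (Or.inl ⟨hD, hbD, ?_⟩), h2, h3⟩
          intro hbD'
          exact hab (congrArg Prod.fst ((hCD b).1 ⟨hb, hbD'⟩)).symm
      · obtain ⟨h1, h2, h3⟩ := exchange_side hab hcl haD haE (h.clash hF hD) (h.clash hF hE)
          hside h.lit_mem hb hbC hXY
        exact Or.inr ⟨C, (mem_dp b).2 (Or.inl ⟨h.mem, hb, hbC⟩), _, hres hD hE h1, h2, h3⟩
    · push Not at hside
      rw [dpImage, if_neg hside.1] at hXY ⊢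
      rw [dpImage, if_neg hside.2] at hXY ⊢
      refine Or.inl ⟨hres hD hE hXY, ?_, ?_⟩
      · rw [mem_resolvent]
        tauto
      · rw [mem_resolvent]
        tauto

/-! ### Persistence of singularity and the exceptional case. -/

/-- `v` and `w` are singular with a common main clause, and neither of them is 1-singular. -/
def ShareMain (F : Finset (Finset (Literal V))) (v w : V) : Prop :=
  ∃ a b C, a.1 = v ∧ b.1 = w ∧ IsMain F a C ∧ IsMain F b C ∧
    2 ≤ literalDegree F a.compl ∧ 2 ≤ literalDegree F b.compl

theorem ShareMain.symm {F : Finset (Finset (Literal V))} {v w : V} (h : ShareMain F v w) :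
    ShareMain F w v := by
  obtain ⟨a, b, C, ha, hb, haC, hbC, h1, h2⟩ := h
  exact ⟨b, a, C, hb, ha, hbC, haC, h2, h1⟩

theorem dp_comm {F : Finset (Finset (Literal V))} (hF : IsMU F) {v w : V}
    (hv : IsSingular F v) (hw : IsSingular F w) : dp v (dp w F) = dp w (dp v F) := by
  by_cases hvw : v = w
  · rw [hvw]
  have key : ∀ v w : V, v ≠ w → IsSingular F v → dp w (dp v F) ⊆ dp v (dp w F) := by
    intro v w hvw hv
    obtain ⟨a, C, rfl, h⟩ := isSingular_iff.1 hv
    -- `C` is clash-free, so the sign of `w` can be chosen with the complement missing from `C`.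
    by_cases hb : (w, true) ∈ C
    · exact h.dp_dp_subset (b := (w, true)) hF hvw
        (isClause_iff.1 (hF.isClauseSet C h.mem) _ hb)
    · exact h.dp_dp_subset (b := (w, false)) hF hvw hb
  exact (key w v (Ne.symm hvw) hw).antisymm (key v w hvw hv)

/-- The degree of `b` can only grow if `b` lies in `C`, which then is the main clause of both. Even
so `w` stays singular if `b.compl`, whose degree is unchanged, has degree 1, or if a single side
clause receives `b`. -/
theorem isSingular_dp_or_shareMain {F : Finset (Finset (Literal V))} (hF : IsMU F) {v w : V}
    (hvw : v ≠ w) (hv : IsSingular F v) (hw : IsSingular F w) :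
    IsSingular (dp v F) w ∨ ShareMain F v w := by
  obtain ⟨a, C, rfl, h⟩ := isSingular_iff.1 hv
  obtain ⟨b, E, rfl, h'⟩ := isSingular_iff.1 hw
  have hba : b.1 ≠ a.1 := Ne.symm hvw
  have hb1 := h'.literalDegree_eq
  have hb2 := literalDegree_pos.2 h'.exists_side
  have hp1 := (h.literalDegree_dp_pos_iff hF hba).2 (by omega)
  have hp2 := (h.literalDegree_dp_pos_iff hF (x := b.compl) hba).2 hb2
  rw [isSingular_iff_literal]
  by_cases hbC : b ∈ C
  · obtain rfl := h'.unique C h.mem hbC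
    have hbc := isClause_iff.1 (hF.isClauseSet C h.mem) b hbC
    have hd := h.literalDegree_dp_of_notMem hF (x := b.compl) hba hbc
    by_cases hb3 : literalDegree F b.compl = 1
    · left
      omega
    have ha2 := literalDegree_pos.2 h.exists_side
    by_cases ha3 : literalDegree F a.compl = 1
    · left
      have hle : literalDegree (dp a.1 F) b ≤ literalDegree F a.compl := by
        rw [h.literalDegree_dp hF hba, literalDegree]
        refine Finset.card_le_card fun D hD => ?_
        simp only [Finset.mem_filter, Finset.mem_erase] at hD ⊢
        refine ⟨hD.1.2, ?_⟩
        rcases hD.2 with hbD | hD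
        · exact absurd (h'.unique D hD.1.2 hbD) hD.1.1
        · exact hD.1
      omega
    · exact Or.inr ⟨a, b, C, rfl, rfl, h, h', by omega, by omega⟩
  · have hd := h.literalDegree_dp_of_notMem hF hba hbC
    left
    omega

/-- If all singular variables have the same main clause and none is 1-singular, then one
reduction step yields a nonsingular clause-set. -/
theorem isNonsingular_dp {F : Finset (Finset (Literal V))} (hF : IsMU F) {a : Literal V}
    {C : Finset (Literal V)} (h : IsMain F a C) (ha : 2 ≤ literalDegree F a.compl)
    (hall : ∀ x, IsSingular F x → ∃ c, c.1 = x ∧ IsMain F c C ∧ 2 ≤ literalDegree F c.compl) :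
    IsNonsingular (dp a.1 F) := by
  intro x hx
  obtain ⟨y, E, rfl, hy⟩ := isSingular_iff.1 hx
  have hy1 := hy.literalDegree_eq
  have hy2 := literalDegree_pos.2 hy.exists_side
  have hya : y.1 ≠ a.1 := fun hya => by
    rw [h.literalDegree_dp_self hF hya] at hy1
    omega
  by_cases hyC : y ∈ C
  · have := h.literalDegree_compl_le hF hya hyC
    omega
  -- Outside `C`, `y` already had degree 1 in `F`; by `hall` its complement lies in `C`, which
  -- forces `y` to have degree at least 2.
  · rw [h.literalDegree_dp_of_notMem hF hya hyC] at hy1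
    rw [h.literalDegree_dp_pos_iff hF (x := y.compl) hya] at hy2
    obtain ⟨B, hB⟩ := exists_isMain hy1 hy2
    obtain ⟨c, hcy, hc, hc2⟩ := hall _ hB.isSingular
    rcases eq_or_eq_compl hcy with rfl | rfl
    · exact hyC hc.lit_mem
    · rw [compl_compl] at hc2
      omega

/-- The degree bound rules out `a.compl` as the singular literal, so the variable has only one main
clause. -/
theorem IsMain.eq_of_two_le {F : Finset (Finset (Literal V))} {a b : Literal V}
    {C E : Finset (Literal V)} (ha : IsMain F a C) (hb : IsMain F b E) (hab : b.1 = a.1)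
    (h2 : 2 ≤ literalDegree F a.compl) : E = C := by
  rcases eq_or_eq_compl hab with rfl | rfl
  · exact ha.unique E hb.mem hb.lit_mem
  · have := hb.literalDegree_eq
    omega

/-! ### Uniqueness of the reduction length. -/

/-- `F` can be reduced to a nonsingular clause-set in `n` singular DP-reduction steps. -/
inductive ReducesIn : Finset (Finset (Literal V)) → ℕ → Prop
  | zero {F : Finset (Finset (Literal V))} (h : IsNonsingular F) : ReducesIn F 0
  | succ {F : Finset (Finset (Literal V))} {v : V} {n : ℕ} (hv : IsSingular F v)
      (h : ReducesIn (dp v F) n) : ReducesIn F (n + 1)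

theorem IsMU.exists_reducesIn {F : Finset (Finset (Literal V))} (hF : IsMU F) :
    ∃ n, ReducesIn F n := by
  induction hk : numVars F generalizing F with
  | zero =>
    refine ⟨0, .zero fun v hv => ?_⟩
    have := numVars_dp hF hv
    omega
  | succ k ih =>
    by_cases h : IsNonsingular F
    · exact ⟨0, .zero h⟩
    · obtain ⟨v, hv⟩ := not_forall_not.1 h
      have := numVars_dp hF hv
      obtain ⟨n, hn⟩ := ih (isMU_dp hF hv) (by omega)
      exact ⟨n + 1, .succ hv hn⟩

/-- All maximal singular reductions of a minimally unsatisfiable clause-set have the same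
length. -/
theorem IsMU.reducesIn_unique {F : Finset (Finset (Literal V))} (hF : IsMU F) {m n : ℕ}
    (hm : ReducesIn F m) (hn : ReducesIn F n) : m = n := by
  induction hk : numVars F using Nat.strong_induction_on generalizing F m n with
  | _ k ih =>
  have ih' : ∀ {v}, IsSingular F v → ∀ {m n}, ReducesIn (dp v F) m → ReducesIn (dp v F) n →
      m = n := fun {v} hv {m n} hm hn => by
    have := numVars_dp hF hv
    exact ih _ (by omega) (isMU_dp hF hv) hm hn rfl
  have join : ∀ {v w}, IsSingular F v → IsSingular F w → ¬ ShareMain F v w →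
      ∀ {m n}, ReducesIn (dp v F) m → ReducesIn (dp w F) n → m = n := by
    intro v w hv hw hs m n hm hn
    by_cases hvw : v = w
    · subst hvw
      exact ih' hv hm hn
    have h1 := (isSingular_dp_or_shareMain hF hvw hv hw).resolve_right hs
    have h2 := (isSingular_dp_or_shareMain hF (Ne.symm hvw) hw hv).resolve_right
      fun h => hs h.symm
    -- The common reduct on `v` and `w` has some length `l`; by induction both one-step reducts have
    -- length `l + 1`.
    obtain ⟨l, hl⟩ := (isMU_dp (isMU_dp hF hv) h1).exists_reducesIn
    rw [ih' hv hm (.succ h1 hl)]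
    rw [← dp_comm hF hv hw] at hl
    exact ih' hw (.succ h2 hl) hn
  cases hm with
  | zero h =>
    cases hn with
    | zero => rfl
    | succ hw _ => exact absurd hw (h _)
  | @succ _ v m hv hm =>
    cases hn with
    | zero h => exact absurd hv (h _)
    | @succ _ w n hw hn =>
      congr 1
      by_cases hs : ShareMain F v w
      · by_cases hx : ∃ x, IsSingular F x ∧ ¬ ShareMain F v x ∧ ¬ ShareMain F x w
        · obtain ⟨x, hx, h1, h2⟩ := hx
          obtain ⟨l, hl⟩ := (isMU_dp hF hx).exists_reducesIn
          exact (join hv hx h1 hm hl).trans (join hx hw h2 hl hn)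
        · obtain ⟨a, b, C, rfl, rfl, ha, hb, ha2, hb2⟩ := hs
          -- With no intermediate variable, each singular `x` is exceptional with `v` or `w`, whose
          -- only main clause is `C`.
          have hall : ∀ x, IsSingular F x →
              ∃ c, c.1 = x ∧ IsMain F c C ∧ 2 ≤ literalDegree F c.compl := by
            intro x hsx
            by_contra hc
            refine hx ⟨x, hsx, ?_, ?_⟩
            · rintro ⟨a', c, E, haa, hcx, ha', hcE, -, hc2⟩
              obtain rfl := ha.eq_of_two_le ha' haa ha2
              exact hc ⟨c, hcx, hcE, hc2⟩
            · rintro ⟨c, b', E, hcx, hbb, hcE, hb', hc2, -⟩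
              obtain rfl := hb.eq_of_two_le hb' hbb hb2
              exact hc ⟨c, hcx, hcE, hc2⟩
          have hna := isNonsingular_dp hF ha ha2 hall
          have hnb := isNonsingular_dp hF hb hb2 hall
          rw [ih' hv hm (.zero hna), ih' hw hn (.zero hnb)]
      · exact join hv hw hs hm hn

/-! ### Translation to singular tuples and `sdp`. -/

theorem isSingularTuple_nil (F : Finset (Finset (Literal V))) : IsSingularTuple F [] :=
  fun _ hi => absurd hi (Nat.not_lt_zero _)

theorem isSingularTuple_cons {F : Finset (Finset (Literal V))} {v : V} {vs : List V} :
    IsSingularTuple F (v :: vs) ↔ IsSingular F v ∧ IsSingularTuple (dp v F) vs := by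
  constructor
  · intro h
    exact ⟨h 0 (Nat.succ_pos _), fun i hi => h (i + 1) (Nat.succ_lt_succ hi)⟩
  · rintro ⟨hv, h⟩ i hi
    cases i with
    | zero => exact hv
    | succ i => exact h i (Nat.lt_of_succ_lt_succ hi)

theorem isMaximalSingularTuple_nil {F : Finset (Finset (Literal V))} :
    IsMaximalSingularTuple F [] ↔ IsNonsingular F := by
  constructor
  · intro h v hv
    have := h.2 [v] (isSingularTuple_cons.2 ⟨hv, isSingularTuple_nil _⟩) List.nil_prefix
    exact List.cons_ne_nil _ _ this
  · refine fun h => ⟨isSingularTuple_nil F, fun ws hws _ => ?_⟩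
    cases ws with
    | nil => rfl
    | cons w ws => exact absurd (isSingularTuple_cons.1 hws).1 (h w)

theorem isMaximalSingularTuple_cons {F : Finset (Finset (Literal V))} {v : V} {vs : List V} :
    IsMaximalSingularTuple F (v :: vs) ↔
      IsSingular F v ∧ IsMaximalSingularTuple (dp v F) vs := by
  constructor
  · intro h
    obtain ⟨hv, hvs⟩ := isSingularTuple_cons.1 h.1
    refine ⟨hv, hvs, fun ws hws hp => ?_⟩
    exact (List.cons.inj (h.2 (v :: ws) (isSingularTuple_cons.2 ⟨hv, hws⟩)
      (List.cons_prefix_cons.2 ⟨rfl, hp⟩))).2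
  · rintro ⟨hv, h⟩
    refine ⟨isSingularTuple_cons.2 ⟨hv, h.1⟩, fun ws hws hp => ?_⟩
    cases ws with
    | nil => exact absurd (List.prefix_nil.1 hp) (List.cons_ne_nil _ _)
    | cons w ws =>
      obtain rfl := (List.cons_prefix_cons.1 hp).1
      rw [h.2 ws (isSingularTuple_cons.1 hws).2 (List.cons_prefix_cons.1 hp).2]

theorem reducesIn_iff {F : Finset (Finset (Literal V))} {n : ℕ} :
    ReducesIn F n ↔ ∃ vs, IsMaximalSingularTuple F vs ∧ vs.length = n := by
  constructor
  · intro h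
    induction h with
    | zero h => exact ⟨[], isMaximalSingularTuple_nil.2 h, rfl⟩
    | succ hv _ ih =>
      obtain ⟨vs, hvs, rfl⟩ := ih
      exact ⟨_, isMaximalSingularTuple_cons.2 ⟨hv, hvs⟩, rfl⟩
  · rintro ⟨vs, hvs, rfl⟩
    induction vs generalizing F with
    | nil => exact .zero (isMaximalSingularTuple_nil.1 hvs)
    | cons v vs ih =>
      obtain ⟨hv, h⟩ := isMaximalSingularTuple_cons.1 hvs
      exact .succ hv (ih h)

theorem exists_reducesIn_of_mem_sdp {F F' : Finset (Finset (Literal V))} (h : F' ∈ sdp F) :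
    ∃ n, ReducesIn F n ∧ numVars F' + n = numVars F := by
  obtain ⟨-, hns, hred⟩ := h
  induction hred using Relation.ReflTransGen.head_induction_on with
  | refl => exact ⟨0, .zero hns, rfl⟩
  | head hstep _ ih =>
    obtain ⟨hG, -, v, hv, rfl⟩ := hstep
    obtain ⟨n, hn, hvar⟩ := ih
    have := numVars_dp hG hv
    exact ⟨n + 1, .succ hv hn, by omega⟩

end

end MinUnsat

theorem theorem5 {V : Type*} [DecidableEq V] (F : Finset (Finset (MinUnsat.Literal V)))
    (hF : MinUnsat.IsMU F) :
    (∃ vs : List V, MinUnsat.IsMaximalSingularTuple F vs ∧ vs.length = MinUnsat.singind F) ∧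
    (∀ vs : List V, MinUnsat.IsMaximalSingularTuple F vs → vs.length = MinUnsat.singind F) ∧
    (∀ F' ∈ MinUnsat.sdp F, ∀ F'' ∈ MinUnsat.sdp F,
      MinUnsat.numVars F' = MinUnsat.numVars F'') := by
  obtain ⟨n, hn⟩ := hF.exists_reducesIn
  have hmin : ∃ vs : List V, MinUnsat.IsMaximalSingularTuple F vs ∧
      vs.length = MinUnsat.singind F :=
    -- Nonemptiness is essential: the infimum of the empty set would be the default value 0.
    Nat.sInf_mem (s := {n | ∃ vs, MinUnsat.IsMaximalSingularTuple F vs ∧ vs.length = n})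
      ⟨n, MinUnsat.reducesIn_iff.1 hn⟩
  refine ⟨hmin, fun vs hvs => ?_, fun F' h' F'' h'' => ?_⟩
  · exact hF.reducesIn_unique (MinUnsat.reducesIn_iff.2 ⟨vs, hvs, rfl⟩)
      (MinUnsat.reducesIn_iff.2 hmin)
  · obtain ⟨k, hk, hvar⟩ := MinUnsat.exists_reducesIn_of_mem_sdp h'
    obtain ⟨l, hl, hvar'⟩ := MinUnsat.exists_reducesIn_of_mem_sdp h''
    have := hF.reducesIn_unique hk hl
    omega
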